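/- Let $\mathcal B$ be a complete Boolean algebra with Stone space $Q$. Let $C(Q)$ be the algebra of continuous functions $Q\to\mathbb R$, and let $L^0(\mathcal B)=C_\infty(Q)$ be the algebra over $\mathbb R$ of all continuous functions $x\colon Q\to[-\infty,+\infty]$ that take the values $\pm\infty$ only on a nowhere dense set; for $x,y\in C_\infty(Q)$, the sum $x+y$ (resp. the product $xy$) is the unique element of $C_\infty(Q)$ that equals $x(t)+y(t)$ (resp. $x(t)y(t)$) at every point $t$ where both $x$ and $y$ are finite. Then $C(Q)\subset L^0(\mathcal B)$, and $e\in\mathcal B$ is identified with the indicator function of the clopen subset of $Q$ corresponding to $e$. The support of $x\in L^0(\mathcal B)$ is $s(x)=\mathbf 1-\sup\{e\in\mathcal B: ex=0\}\in\mathcal B$, and for $X\subset L^0(\mathcal B)$ put $s(X)=\sup\{s(x):x\in X\}$. If $X$ is an ideal of $C(Q)$ or $X=L^0(\mathcal B)$, a derivation $\delta\colon X\to L^0(\mathcal B)$ is an $\mathbb R$-linear map with $\delta(xy)=\delta(x)y+x\delta(y)$ for all $x,y\in X$; a derivation $\delta$ on an ideal $X$ is band preserving if $s(\delta(x))\le s(x)$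 for all $x\in X$. **Theorem.** Let $X$ be an ideal of $C(Q)$ and let $\delta\colon X\to L^0(\mathcal B)$ be a band preserving derivation. Then there exists a derivation $\hat\delta\colon L^0(\mathcal B)\to L^0(\mathcal B)$ such that $\hat\delta(x)=\delta(x)$ for all $x\in X$. If moreover $s(X)=\mathbf 1$, then such a derivation $\hat\delta$ is unique. -/

import Mathlib

open Set Filter Topology

noncomputable section

universe u

/-! ### The Stone space of a Boolean algebra -/

/-- The Stone space of a Boolean algebra `B`: the two-valued homomorphisms `B → Bool`
(equivalently, the ultrafilters of `B`), with the topology of pointwise convergence. -/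
def StoneSpace (B : Type u) [BooleanAlgebra B] : Type u := BoundedLatticeHom B Bool

namespace StoneSpace

section Boolean

variable {B : Type u} [BooleanAlgebra B]

/-- The value of a point of the Stone space at an element of the Boolean algebra. -/
def val (t : StoneSpace B) : B → Bool := fun b => DFunLike.coe (F := BoundedLatticeHom B Bool) t b

theorem val_injective : Function.Injective (val (B := B)) := fun _ _ h =>
  DFunLike.coe_injective (F := BoundedLatticeHom B Bool) h

@[simp] theorem val_sup (t : StoneSpace B) (a b : B) : t.val (a ⊔ b) = (t.val a ⊔ t.val b) :=
  map_sup (F := BoundedLatticeHom B Bool) t a b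

@[simp] theorem val_inf (t : StoneSpace B) (a b : B) : t.val (a ⊓ b) = (t.val a ⊓ t.val b) :=
  map_inf (F := BoundedLatticeHom B Bool) t a b

@[simp] theorem val_top (t : StoneSpace B) : t.val ⊤ = true :=
  map_top (F := BoundedLatticeHom B Bool) t

@[simp] theorem val_bot (t : StoneSpace B) : t.val ⊥ = false :=
  map_bot (F := BoundedLatticeHom B Bool) t

instance : TopologicalSpace (StoneSpace B) := TopologicalSpace.induced val inferInstance

theorem isInducing_val : IsInducing (val (B := B)) := ⟨rfl⟩

theorem continuous_val : Continuous (val (B := B)) := continuous_induced_dom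

theorem continuous_val_apply (b : B) : Continuous fun t : StoneSpace B => t.val b :=
  (continuous_apply b).comp continuous_val

theorem range_val : range (val (B := B)) =
    {f : B → Bool | (∀ a b, f (a ⊔ b) = (f a ⊔ f b)) ∧ (∀ a b, f (a ⊓ b) = (f a ⊓ f b)) ∧
      f ⊤ = true ∧ f ⊥ = false} := by
  ext f
  constructor
  · rintro ⟨t, rfl⟩
    exact ⟨t.val_sup, t.val_inf, t.val_top, t.val_bot⟩
  · rintro ⟨h1, h2, h3, h4⟩
    exact ⟨(⟨⟨⟨f, h1⟩, h2⟩, h3, h4⟩ : BoundedLatticeHom B Bool), rfl⟩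

instance : CompactSpace (StoneSpace B) := by
  have hcl : IsClosed (range (val (B := B))) := by
    rw [range_val]
    have hsup : Continuous fun p : Bool × Bool => p.1 ⊔ p.2 := continuous_of_discreteTopology
    have hinf : Continuous fun p : Bool × Bool => p.1 ⊓ p.2 := continuous_of_discreteTopology
    simp only [ofPred_and, ofPred_forall]
    refine IsClosed.inter ?_ (IsClosed.inter ?_ (IsClosed.inter ?_ ?_))
    · refine isClosed_iInter fun a => isClosed_iInter fun b => isClosed_eq (continuous_apply _) ?_
      exact hsup.comp (f := fun x : B → Bool => (x a, x b))
        ((continuous_apply a).prodMk (continuous_apply b))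
    · refine isClosed_iInter fun a => isClosed_iInter fun b => isClosed_eq (continuous_apply _) ?_
      exact hinf.comp (f := fun x : B → Bool => (x a, x b))
        ((continuous_apply a).prodMk (continuous_apply b))
    · exact isClosed_eq (continuous_apply _) continuous_const
    · exact isClosed_eq (continuous_apply _) continuous_const
  exact (IsClosedEmbedding.mk ⟨isInducing_val, val_injective⟩ hcl).compactSpace

instance : T2Space (StoneSpace B) := T2Space.of_injective_continuous val_injective continuous_val

/-- The clopen subset `Q(e)` of the Stone space that corresponds to `e`. -/
def clopen (e : B) : Set (StoneSpace B) := {t | t.val e = true}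

theorem isClopen_clopen (e : B) : IsClopen (clopen e) :=
  (isClopen_discrete ({true} : Set Bool)).preimage (continuous_val_apply e)

theorem val_compl (t : StoneSpace B) (b : B) : t.val bᶜ = !(t.val b) := by
  have h1 := t.val_sup b bᶜ
  have h2 := t.val_inf b bᶜ
  simp only [sup_compl_eq_top, inf_compl_eq_bot, val_top, val_bot] at h1 h2
  revert h1 h2
  cases t.val b <;> cases t.val bᶜ <;> simp

theorem exists_clopen_subset {U : Set (StoneSpace B)} (hU : IsOpen U) {t : StoneSpace B}
    (ht : t ∈ U) : ∃ e : B, t ∈ clopen e ∧ clopen e ⊆ U := by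
  obtain ⟨V, hV, rfl⟩ := isInducing_val.isOpen_iff.1 hU
  obtain ⟨I, w, hw, hIV⟩ := isOpen_pi_iff.1 hV t.val ht
  refine ⟨I.inf fun b => if t.val b = true then b else bᶜ, ?_, ?_⟩
  · have key : ∀ J : Finset B,
        t.val (J.inf fun b => if t.val b = true then b else bᶜ) = true := by
      intro J
      classical
      induction J using Finset.induction_on with
      | empty => simp
      | insert a J _ ih =>
        rw [Finset.inf_insert, val_inf, ih]
        split_ifs with h
        · simp [h]
        · simp [val_compl, h]
    exact key I
  · intro s hs
    refine hIV fun b hb => ?_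
    have h1 : s.val (if t.val b = true then b else bᶜ) = true := by
      have hle : (I.inf fun b => if t.val b = true then b else bᶜ) ≤
          (if t.val b = true then b else bᶜ) := Finset.inf_le hb
      have h2 := s.val_inf (I.inf fun b => if t.val b = true then b else bᶜ)
        (if t.val b = true then b else bᶜ)
      rw [inf_eq_left.2 hle, show s.val (I.inf fun b => if t.val b = true then b else bᶜ) = true
        from hs] at h2
      simpa using h2.symm
    have h3 : s.val b = t.val b := by
      split_ifs at h1 with h
      · rw [h1, h]
      · rw [val_compl] at h1
        simp only [Bool.not_eq_true'] at h1
        simp only [Bool.not_eq_true] at h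
        rw [h1, h]
    rw [h3]
    exact (hw b hb).2

theorem nonempty_clopen {e : B} (he : e ≠ ⊥) : (clopen e).Nonempty := by
  classical
  have hdis : Disjoint (Order.PFilter.principal e : Set B) ((⊥ : Order.Ideal B) : Set B) := by
    rw [Set.disjoint_left]
    rintro x hx hx'
    have h1 : e ≤ x := hx
    have h2 : x ≤ ⊥ := hx'
    exact he (le_bot_iff.1 (h1.trans h2))
  obtain ⟨J, hJ, -, hJd⟩ := DistribLattice.prime_ideal_of_disjoint_filter_ideal hdis
  have hmem : (fun b => decide (b ∉ J)) ∈ range (val (B := B)) := by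
    rw [range_val]
    refine ⟨fun a b => ?_, fun a b => ?_, ?_, ?_⟩
    · by_cases ha : a ∈ J <;> by_cases hb : b ∈ J <;> simp [ha, hb]
    · have h : a ⊓ b ∈ J ↔ a ∈ J ∨ b ∈ J :=
        ⟨fun h => hJ.mem_or_mem h,
          fun h => h.elim (fun h => J.lower inf_le_left h) fun h => J.lower inf_le_right h⟩
      by_cases ha : a ∈ J <;> by_cases hb : b ∈ J <;> simp [h, ha, hb]
    · have h : (⊤ : B) ∉ J := hJ.toIsProper.top_notMem
      simp [h]
    · simp
  obtain ⟨t, ht⟩ := hmem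
  refine ⟨t, ?_⟩
  have h : e ∉ J := Set.disjoint_left.1 hJd (le_refl e)
  show t.val e = true
  rw [ht]
  simp [h]

end Boolean

instance {B : Type u} [CompleteBooleanAlgebra B] : ExtremallyDisconnected (StoneSpace B) where
  open_closure U hU := by
    have hmono : ∀ {a b : B}, a ≤ b → clopen a ⊆ clopen b := by
      intro a b hab t (ht : t.val a = true)
      have h := t.val_inf a b
      rw [inf_eq_left.2 hab, ht] at h
      exact show t.val b = true by simpa using h.symm
    have hcl : closure U = clopen (sSup {b : B | clopen b ⊆ U}) := by
      apply Subset.antisymm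
      · refine closure_minimal (fun t ht => ?_) (isClopen_clopen _).isClosed
        obtain ⟨e, hte, heU⟩ := exists_clopen_subset hU ht
        exact hmono (le_sSup heU) hte
      · intro t ht
        by_contra hcon
        obtain ⟨c, htc, hc⟩ := exists_clopen_subset isClosed_closure.isOpen_compl hcon
        have h0 : c ⊓ sSup {b : B | clopen b ⊆ U} ≤ ⊥ := by
          rw [inf_sSup_eq]
          refine iSup₂_le fun b hb => ?_
          have hempty : clopen (c ⊓ b) = (∅ : Set (StoneSpace B)) := by
            refine eq_empty_of_forall_notMem fun s hs => ?_
            exact hc (hmono inf_le_left hs) (subset_closure (hb (hmono inf_le_right hs)))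
          by_contra hne
          exact (nonempty_clopen (fun h => hne h.le)).ne_empty hempty
        have h1 := t.val_inf c (sSup {b : B | clopen b ⊆ U})
        rw [le_bot_iff.1 h0, show t.val c = true from htc,
          show t.val (sSup {b : B | clopen b ⊆ U}) = true from ht] at h1
        simp at h1
    rw [hcl]
    exact (isClopen_clopen _).isOpen

end StoneSpace

/-! ### The algebra `C_∞(Q)` -/

section Extension

variable {Q : Type u} [TopologicalSpace Q]

/-- On an extremally disconnected compact Hausdorff space, a continuous function with values in
`[-∞, +∞]` extends from a dense open set to the whole space. -/
theorem exists_continuous_extension [CompactSpace Q] [T2Space Q] [ExtremallyDisconnected Q]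
    {U : Set Q} (hU : IsOpen U) (hd : Dense U) {f : Q → EReal} (hf : ContinuousOn f U) :
    ∃ z : C(Q, EReal), ∀ t ∈ U, z t = f t := by
  let G : Set (Q × EReal) := closure ((fun t => (t, f t)) '' U)
  have hG : IsClosed G := isClosed_closure
  have : CompactSpace G := isCompact_iff_compactSpace.1 hG.isCompact
  have hsurj : Function.Surjective fun p : G => p.1.1 := by
    have hcl : IsClosed (Prod.fst '' G) := (hG.isCompact.image continuous_fst).isClosed
    have hsub : U ⊆ Prod.fst '' G := fun t ht => ⟨(t, f t), subset_closure ⟨t, ht, rfl⟩, rfl⟩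
    intro t
    have ht : t ∈ Prod.fst '' G := closure_minimal hsub hcl (hd t)
    obtain ⟨p, hp, rfl⟩ := ht
    exact ⟨⟨p, hp⟩, rfl⟩
  obtain ⟨h, hc, hh⟩ := CompactT2.ExtremallyDisconnected.projective (A := Q)
    (f := id) continuous_id (continuous_fst.comp continuous_subtype_val) hsurj
  refine ⟨⟨fun t => (h t).1.2, continuous_snd.comp (continuous_subtype_val.comp hc)⟩, ?_⟩
  intro t ht
  by_contra hne
  have hfst : (h t).1.1 = t := congrFun hh t
  obtain ⟨V, W, hV, hW, hzV, hfW, hVW⟩ := t2_separation hne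
  have hN : IsOpen (U ∩ f ⁻¹' W) := hf.isOpen_inter_preimage hU hW
  have hmem : (h t).1 ∈ (U ∩ f ⁻¹' W) ×ˢ V := by
    refine ⟨?_, hzV⟩
    rw [hfst]
    exact ⟨ht, hfW⟩
  obtain ⟨p, ⟨hp1, hp2⟩, s, hs, rfl⟩ := mem_closure_iff.1 (h t).2 _ (hN.prod hV) hmem
  exact Set.disjoint_left.1 hVW hp2 hp1.2

/-- The filter generated by the dense open sets. -/
def denseOpen (Q : Type u) [TopologicalSpace Q] : Filter Q where
  sets := {s | ∃ U ⊆ s, IsOpen U ∧ Dense U}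
  univ_sets := ⟨univ, subset_univ _, isOpen_univ, dense_univ⟩
  sets_of_superset := fun ⟨U, hU, h⟩ hst => ⟨U, hU.trans hst, h⟩
  inter_sets := fun ⟨U, hU, hUo, hUd⟩ ⟨V, hV, hVo, hVd⟩ =>
    ⟨U ∩ V, inter_subset_inter hU hV, hUo.inter hVo, hUd.inter_of_isOpen_left hVd hUo⟩

end Extension

/-- `C_∞(Q)`: the continuous functions `Q → [-∞, +∞]` that take the values `±∞` only on a nowhere
dense set. -/
@[ext]
structure CInfty (Q : Type u) [TopologicalSpace Q] where
  /-- the underlying continuous function -/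
  toMap : C(Q, EReal)
  nowhereDense : IsNowhereDense {t | toMap t = ⊤ ∨ toMap t = ⊥}

namespace CInfty

section Basic

variable {Q : Type u} [TopologicalSpace Q]

instance : CoeFun (CInfty Q) fun _ => Q → EReal := ⟨fun x => x.toMap⟩

/-- The open dense set on which `x` is finite. -/
def finiteSet (x : CInfty Q) : Set Q := {t | x t ≠ ⊤ ∧ x t ≠ ⊥}

theorem isOpen_finiteSet (x : CInfty Q) : IsOpen x.finiteSet :=
  (isOpen_ne.preimage x.toMap.continuous).inter (isOpen_ne.preimage x.toMap.continuous)

theorem compl_finiteSet (x : CInfty Q) : x.finiteSetᶜ = {t | x t = ⊤ ∨ x t = ⊥} := by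
  ext t
  simp only [finiteSet, mem_compl_iff, mem_ofPred_eq]
  tauto

theorem dense_finiteSet (x : CInfty Q) : Dense x.finiteSet := by
  have h := x.nowhereDense
  rw [← compl_finiteSet, x.isOpen_finiteSet.isClosed_compl.isNowhereDense_iff,
    interior_eq_empty_iff_dense_compl, compl_compl] at h
  exact h

theorem coe_toReal {x : CInfty Q} {t : Q} (ht : t ∈ x.finiteSet) :
    (((x t).toReal : ℝ) : EReal) = x t := EReal.coe_toReal ht.1 ht.2

theorem eventually_finite (x : CInfty Q) : ∀ᶠ t in denseOpen Q, t ∈ x.finiteSet :=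
  ⟨x.finiteSet, Subset.rfl, x.isOpen_finiteSet, x.dense_finiteSet⟩

theorem continuousOn_toReal (x : CInfty Q) : ContinuousOn (fun t => (x t).toReal) x.finiteSet :=
  EReal.continuousOn_toReal.comp x.toMap.continuous.continuousOn fun t ht => by
    simp [ht.1, ht.2]

/-- Two elements of `C_∞(Q)` that agree on a dense open set are equal. -/
theorem eq_of_eventually {x y : CInfty Q}
    (h : ∀ᶠ t in denseOpen Q, (x t).toReal = (y t).toReal) : x = y := by
  obtain ⟨U, hU, -, hUd⟩ : {t | x t = y t} ∈ denseOpen Q := by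
    filter_upwards [h, x.eventually_finite, y.eventually_finite] with t h hx hy
    show x t = y t
    rw [← coe_toReal hx, ← coe_toReal hy, h]
  refine CInfty.ext (ContinuousMap.ext fun t => ?_)
  exact congrFun (Continuous.ext_on hUd x.toMap.continuous y.toMap.continuous hU) t

/-- A finite continuous function as an element of `C_∞(Q)`. -/
def ofReal (a : C(Q, ℝ)) : CInfty Q where
  toMap := ⟨fun t => (a t : EReal), continuous_coe_real_ereal.comp a.continuous⟩
  nowhereDense := by simp [IsNowhereDense]

@[simp] theorem ofReal_apply (a : C(Q, ℝ)) (t : Q) : ofReal a t = (a t : EReal) := rfl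

instance : Neg (CInfty Q) where
  neg x :=
    { toMap := ⟨fun t => -x t, continuous_neg.comp x.toMap.continuous⟩
      nowhereDense := by
        have h : {t | -x t = ⊤ ∨ -x t = ⊥} = {t | x t = ⊤ ∨ x t = ⊥} := by
          ext t
          simp only [mem_ofPred_eq, EReal.neg_eq_top_iff, EReal.neg_eq_bot_iff]
          tauto
        exact h ▸ x.nowhereDense }

theorem neg_apply (x : CInfty Q) (t : Q) : (-x) t = -x t := rfl

instance : Zero (CInfty Q) := ⟨ofReal 0⟩
instance : One (CInfty Q) := ⟨ofReal 1⟩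

theorem toReal_zero (t : Q) : ((0 : CInfty Q) t).toReal = 0 := EReal.toReal_coe 0

theorem toReal_one (t : Q) : ((1 : CInfty Q) t).toReal = 1 := EReal.toReal_coe 1

theorem toReal_ofReal (a : C(Q, ℝ)) (t : Q) : (ofReal a t).toReal = a t := EReal.toReal_coe _

theorem toReal_neg (x : CInfty Q) (t : Q) : ((-x) t).toReal = -(x t).toReal := by
  rw [neg_apply, EReal.toReal_neg_eq]

end Basic

variable {Q : Type u} [TopologicalSpace Q] [CompactSpace Q] [T2Space Q] [ExtremallyDisconnected Q]

theorem exists_map₂ (F : ℝ → ℝ → ℝ) (hF : Continuous fun p : ℝ × ℝ => F p.1 p.2)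
    (x y : CInfty Q) : ∃ z : CInfty Q, ∀ t ∈ x.finiteSet ∩ y.finiteSet,
      z t = (F (x t).toReal (y t).toReal : ℝ) := by
  have ho := x.isOpen_finiteSet.inter y.isOpen_finiteSet
  have hd := x.dense_finiteSet.inter_of_isOpen_left y.dense_finiteSet x.isOpen_finiteSet
  have hc : ContinuousOn (fun t => ((F (x t).toReal (y t).toReal : ℝ) : EReal))
      (x.finiteSet ∩ y.finiteSet) :=
    (continuous_coe_real_ereal.comp hF).comp_continuousOn
      ((x.continuousOn_toReal.mono inter_subset_left).prodMk
        (y.continuousOn_toReal.mono inter_subset_right))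
  obtain ⟨z, hz⟩ := exists_continuous_extension ho hd hc
  refine ⟨⟨z, ?_⟩, hz⟩
  refine IsNowhereDense.mono (t := {t | z t = ⊤ ∨ z t = ⊥})
    (s := (x.finiteSet ∩ y.finiteSet)ᶜ) ?_ ?_
  · intro t ht hmem
    rw [mem_ofPred_eq, hz t hmem] at ht
    exact ht.elim (EReal.coe_ne_top _) (EReal.coe_ne_bot _)
  · rw [ho.isClosed_compl.isNowhereDense_iff, interior_eq_empty_iff_dense_compl, compl_compl]
    exact hd

/-- The element of `C_∞(Q)` whose value is `F (x t) (y t)` at all points `t` where both `x` and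
`y` are finite; by density and continuity it is unique. -/
def map₂ (F : ℝ → ℝ → ℝ) (hF : Continuous fun p : ℝ × ℝ => F p.1 p.2) (x y : CInfty Q) :
    CInfty Q := (exists_map₂ F hF x y).choose

theorem map₂_apply (F : ℝ → ℝ → ℝ) (hF : Continuous fun p : ℝ × ℝ => F p.1 p.2)
    (x y : CInfty Q) {t : Q} (hx : t ∈ x.finiteSet) (hy : t ∈ y.finiteSet) :
    map₂ F hF x y t = (F (x t).toReal (y t).toReal : ℝ) :=
  (exists_map₂ F hF x y).choose_spec t ⟨hx, hy⟩

instance : Add (CInfty Q) := ⟨map₂ (fun a b => a + b) continuous_add⟩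
instance : Mul (CInfty Q) := ⟨map₂ (fun a b => a * b) continuous_mul⟩

theorem add_apply (x y : CInfty Q) {t : Q} (hx : t ∈ x.finiteSet) (hy : t ∈ y.finiteSet) :
    (x + y) t = (((x t).toReal + (y t).toReal : ℝ) : EReal) := map₂_apply _ _ x y hx hy

theorem mul_apply (x y : CInfty Q) {t : Q} (hx : t ∈ x.finiteSet) (hy : t ∈ y.finiteSet) :
    (x * y) t = (((x t).toReal * (y t).toReal : ℝ) : EReal) := map₂_apply _ _ x y hx hy

theorem toReal_add (x y : CInfty Q) :
    ∀ᶠ t in denseOpen Q, ((x + y) t).toReal = (x t).toReal + (y t).toReal := by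
  filter_upwards [x.eventually_finite, y.eventually_finite] with t hx hy
  rw [add_apply x y hx hy, EReal.toReal_coe]

theorem toReal_mul (x y : CInfty Q) :
    ∀ᶠ t in denseOpen Q, ((x * y) t).toReal = (x t).toReal * (y t).toReal := by
  filter_upwards [x.eventually_finite, y.eventually_finite] with t hx hy
  rw [mul_apply x y hx hy, EReal.toReal_coe]

instance : CommRing (CInfty Q) where
  add_assoc x y z := eq_of_eventually <| by
    filter_upwards [toReal_add (x + y) z, toReal_add x y, toReal_add x (y + z), toReal_add y z]
      with t h1 h2 h3 h4
    rw [h1, h2, h3, h4, add_assoc]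
  zero_add x := eq_of_eventually <| by
    filter_upwards [toReal_add 0 x] with t h
    rw [h, toReal_zero, zero_add]
  add_zero x := eq_of_eventually <| by
    filter_upwards [toReal_add x 0] with t h
    rw [h, toReal_zero, add_zero]
  add_comm x y := eq_of_eventually <| by
    filter_upwards [toReal_add x y, toReal_add y x] with t h1 h2
    rw [h1, h2, add_comm]
  neg_add_cancel x := eq_of_eventually <| by
    filter_upwards [toReal_add (-x) x] with t h
    rw [h, toReal_neg, toReal_zero, neg_add_cancel]
  mul_assoc x y z := eq_of_eventually <| by
    filter_upwards [toReal_mul (x * y) z, toReal_mul x y, toReal_mul x (y * z), toReal_mul y z]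
      with t h1 h2 h3 h4
    rw [h1, h2, h3, h4, mul_assoc]
  one_mul x := eq_of_eventually <| by
    filter_upwards [toReal_mul 1 x] with t h
    rw [h, toReal_one, one_mul]
  mul_one x := eq_of_eventually <| by
    filter_upwards [toReal_mul x 1] with t h
    rw [h, toReal_one, mul_one]
  mul_comm x y := eq_of_eventually <| by
    filter_upwards [toReal_mul x y, toReal_mul y x] with t h1 h2
    rw [h1, h2, mul_comm]
  zero_mul x := eq_of_eventually <| by
    filter_upwards [toReal_mul 0 x] with t h
    rw [h, toReal_zero, zero_mul]
  mul_zero x := eq_of_eventually <| by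
    filter_upwards [toReal_mul x 0] with t h
    rw [h, toReal_zero, mul_zero]
  left_distrib x y z := eq_of_eventually <| by
    filter_upwards [toReal_mul x (y + z), toReal_add y z, toReal_add (x * y) (x * z),
      toReal_mul x y, toReal_mul x z] with t h1 h2 h3 h4 h5
    rw [h1, h2, h3, h4, h5, mul_add]
  right_distrib x y z := eq_of_eventually <| by
    filter_upwards [toReal_mul (x + y) z, toReal_add x y, toReal_add (x * z) (y * z),
      toReal_mul x z, toReal_mul y z] with t h1 h2 h3 h4 h5
    rw [h1, h2, h3, h4, h5, add_mul]
  nsmul := nsmulRec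
  zsmul := zsmulRec

/-- The inclusion `C(Q) ⊂ C_∞(Q)` as a ring homomorphism. -/
def incl : C(Q, ℝ) →+* CInfty Q where
  toFun := ofReal
  map_one' := rfl
  map_zero' := rfl
  map_mul' a b := eq_of_eventually <| by
    filter_upwards [toReal_mul (ofReal a) (ofReal b)] with t h
    rw [h, toReal_ofReal, toReal_ofReal, toReal_ofReal, ContinuousMap.mul_apply]
  map_add' a b := eq_of_eventually <| by
    filter_upwards [toReal_add (ofReal a) (ofReal b)] with t h
    rw [h, toReal_ofReal, toReal_ofReal, toReal_ofReal, ContinuousMap.add_apply]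

@[simp] theorem incl_apply (a : C(Q, ℝ)) (t : Q) : incl a t = (a t : EReal) := rfl

/-- `C_∞(Q)` as an algebra over `ℝ`: a real number acts as the constant function. -/
instance : Algebra ℝ (CInfty Q) := (incl.comp (algebraMap ℝ C(Q, ℝ))).toAlgebra

end CInfty

/-! ### The algebra `L⁰(B)`, supports and derivations -/

section LZero

variable {B : Type u} [CompleteBooleanAlgebra B]

/-- `L⁰(B) = C_∞(Q)` for the Stone space `Q` of the complete Boolean algebra `B`. -/
abbrev LZero (B : Type u) [CompleteBooleanAlgebra B] : Type u := CInfty (StoneSpace B)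

/-- The indicator function of the clopen set `Q(e)`. -/
def idemFun (e : B) : C(StoneSpace B, ℝ) where
  toFun := (StoneSpace.clopen e).indicator 1
  continuous_toFun := (StoneSpace.isClopen_clopen e).continuous_indicator continuous_const

/-- The element `e` of `B` as an idempotent of `L⁰(B)`. -/
def idem (e : B) : LZero B := CInfty.incl (idemFun e)

/-- The support `s(x) = 1 - sup {e ∈ B : e x = 0}` of `x ∈ L⁰(B)`. -/
def supp (x : LZero B) : B := (sSup {e : B | idem e * x = 0})ᶜ

/-- The support `s(X) = sup {s(x) : x ∈ X}` of an ideal `X` of `C(Q)`. -/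
def idealSupp (X : Ideal C(StoneSpace B, ℝ)) : B := ⨆ x : X, supp (CInfty.incl x.1)

/-- A linear map `δ : X → L⁰(B)` on an ideal `X` of `C(Q)` is a derivation if
`δ(xy) = δ(x)y + xδ(y)` for all `x, y ∈ X`. -/
def IsIdealDerivation (X : Ideal C(StoneSpace B, ℝ)) (δ : X →ₗ[ℝ] LZero B) : Prop :=
  ∀ x y : X, δ ⟨x.1 * y.1, X.mul_mem_left x.1 y.2⟩ =
    δ x * CInfty.incl y.1 + CInfty.incl x.1 * δ y

/-- `δ` is band preserving if `s(δ(x)) ≤ s(x)` for all `x ∈ X`. -/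
def IsBandPreserving (X : Ideal C(StoneSpace B, ℝ)) (δ : X →ₗ[ℝ] LZero B) : Prop :=
  ∀ x : X, supp (δ x) ≤ supp (CInfty.incl x.1)

end LZero

end

/-!
For `a ∈ C(Q)` consider the commutator `[δ, a] : x ↦ δ(ax) - aδ(x)` on `X`. The Leibniz rule gives
`y[δ, a](x) = x[δ, a](y)`, and since `δ` is band preserving this forces `[δ, a]` to be
`C(Q)`-linear. As `C_∞(Q)` is an injective `C(Q)`-module, `[δ, a]` is multiplication by an element
`d(a) ∈ C_∞(Q)`, unique once it is required to lie in the band `s(X)C_∞(Q)`. By uniqueness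
`d : C(Q) → C_∞(Q)` is a derivation, and `[δ, y](x) = xδ(y)` for `y ∈ X`, so `d` extends `δ`.
Finally, `C_∞(Q)` is the total ring of fractions of `C(Q)`, because
`z = (z / (1 + z²)) / (1 / (1 + z²))`. It is therefore formally étale over `C(Q)`, and derivations
extend to it uniquely. If `s(X) = 1`, then `X` has zero annihilator in `C_∞(Q)`, so `d` is itself
determined by its restriction to `X`: compare `D(ax)` with `aD(x)`.
-/

section Algebra

open scoped TensorProduct KaehlerDifferential

theorem existsUnique_derivation_comp_algebraMap_eq (k R S : Type*) {M : Type*} [CommRing k]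
    [CommRing R] [CommRing S] [Algebra k R] [Algebra k S] [Algebra R S] [IsScalarTower k R S]
    [AddCommGroup M] [Module k M] [Module R M] [Module S M] [IsScalarTower k R M]
    [IsScalarTower k S M] [IsScalarTower R S M] [Algebra.FormallyEtale R S]
    (d : Derivation k R M) :
    ∃! D : Derivation k S M, ∀ a, D (algebraMap R S a) = d a := by
  let e := KaehlerDifferential.tensorKaehlerEquivOfFormallyEtale k R S
  let φ : S ⊗[R] Ω[R⁄k] →ₗ[S] M := d.liftKaehlerDifferential.liftBaseChange S
  refine ⟨(φ ∘ₗ e.symm.toLinearMap).compDer (KaehlerDifferential.D k S), fun a => ?_,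
    fun D hD => ?_⟩
  · simp [e, φ, KaehlerDifferential.tensorKaehlerEquivOfFormallyEtale_symm_D_algebraMap]
  · have hDφ : D.liftKaehlerDifferential ∘ₗ e.toLinearMap = φ := by
      apply TensorProduct.AlgebraTensorModule.curry_injective
      ext a
      simp [e, φ, hD]
    rw [← hDφ, LinearMap.comp_assoc]
    ext z
    simp

theorem derivation_eq_of_eqOn_ideal {k R M : Type*} [CommSemiring k] [CommSemiring R]
    [Algebra k R] [AddCommGroup M] [Module k M] [Module R M] {I : Ideal R}
    (hI : ∀ m : M, (∀ x ∈ I, x • m = 0) → m = 0)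
    {D D' : Derivation k R M} (h : ∀ x ∈ I, D x = D' x) : D = D' := by
  ext a
  refine sub_eq_zero.1 (hI _ fun x hx => ?_)
  have hax := h (a * x) (I.mul_mem_left a hx)
  rw [D.leibniz, D'.leibniz, h x hx] at hax
  rw [smul_sub, sub_eq_zero]
  exact add_left_cancel hax

/-- A derivation `δ : I → S` on an ideal `I` of `R` which is local: whatever annihilates `x` in `S`
also annihilates `δ x`. This is the algebraic form of band preservation. -/
structure IsLocalIdealDerivation {k R S : Type*} [CommSemiring k] [CommRing R] [CommRing S]
    [Algebra k R] [Algebra k S] [Algebra R S] (I : Ideal R) (δ : I →ₗ[k] S) : Prop where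
  leibniz : ∀ x y : I, δ (x.1 • y) = x.1 • δ y + y.1 • δ x
  mul_eq_zero : ∀ (s : S) (x : I), s * algebraMap R S x = 0 → s * δ x = 0

/-- The idempotent `e` is the support of the ideal `I` in the `R`-algebra `S`: it has the same
annihilator in `S` as `I`. -/
structure IsSupportIdempotent {R S : Type*} [CommRing R] [CommRing S] [Algebra R S] (I : Ideal R)
    (e : S) : Prop where
  isIdempotentElem : IsIdempotentElem e
  mul_eq_zero_iff : ∀ s : S, s * e = 0 ↔ ∀ x ∈ I, s * algebraMap R S x = 0

namespace IsSupportIdempotent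

variable {R S : Type*} [CommRing R] [CommRing S] [Algebra R S] {I : Ideal R} {e : S}

theorem mul_algebraMap (he : IsSupportIdempotent I e) {x : R} (hx : x ∈ I) :
    e * algebraMap R S x = algebraMap R S x := by
  have h := (he.mul_eq_zero_iff (1 - e)).1 (by rw [sub_mul, one_mul, he.isIdempotentElem, sub_self])
  linear_combination -h x hx

theorem eq_of_forall_smul_eq (he : IsSupportIdempotent I e) {s t : S} (hs : s * e = s)
    (ht : t * e = t) (h : ∀ x ∈ I, x • s = x • t) : s = t := by
  have hst := (he.mul_eq_zero_iff (s - t)).2 fun x hx => by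
    rw [mul_comm, ← Algebra.smul_def, smul_sub, h x hx, sub_self]
  linear_combination hst - hs + ht

theorem eq_zero_of_forall_smul_eq_zero (he : IsSupportIdempotent I (1 : S)) {s : S}
    (h : ∀ x ∈ I, x • s = 0) : s = 0 :=
  he.eq_of_forall_smul_eq (mul_one s) (mul_one 0) fun x hx => (h x hx).trans (smul_zero x).symm

theorem exists_forall_smul_eq (he : IsSupportIdempotent I e) (hS : Module.Baer R S)
    (f : I →ₗ[R] S) : ∃ w : S, w * e = w ∧ ∀ x : I, x.1 • w = f x := by
  obtain ⟨g, hg⟩ := hS I f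
  refine ⟨g 1 * e, by rw [mul_assoc, he.isIdempotentElem], fun x => ?_⟩
  calc x.1 • (g 1 * e) = g 1 * (e * algebraMap R S x) := by rw [Algebra.smul_def]; ring
    _ = x.1 • g 1 := by rw [he.mul_algebraMap x.2, mul_comm, Algebra.smul_def]
    _ = f x := by rw [← map_smul, smul_eq_mul, mul_one, hg x x.2]

end IsSupportIdempotent

namespace IsLocalIdealDerivation

variable {k R S : Type*} [CommSemiring k] [CommRing R] [CommRing S] [Algebra k R] [Algebra k S]
  [Algebra R S] {I : Ideal R} {δ : I →ₗ[k] S}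

theorem smul_commutator (hδ : IsLocalIdealDerivation I δ) (a : R) (x y : I) :
    x.1 • (δ (a • y) - a • δ y) = y.1 • (δ (a • x) - a • δ x) := by
  have hxy := hδ.leibniz x (a • y)
  have hyx := hδ.leibniz y (a • x)
  have hcomm : x.1 • a • y = y.1 • a • x := by
    ext1
    simp only [Submodule.coe_smul, smul_eq_mul]
    ring
  rw [hcomm, hyx] at hxy
  simp only [Submodule.coe_smul, smul_eq_mul, Algebra.smul_def, map_mul] at hxy ⊢
  linear_combination -hxy

theorem map_mul_eq_self (hδ : IsLocalIdealDerivation I δ) {e : S} (he : IsSupportIdempotent I e)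
    (x : I) : δ x * e = δ x := by
  have h := hδ.mul_eq_zero (1 - e) x (by rw [sub_mul, one_mul, he.mul_algebraMap x.2, sub_self])
  linear_combination -h

/-- The commutator `[δ, a]` of `δ` with multiplication by `a`. It maps into the band `e * S`, where
an element is determined by its multiples by `I`; this makes it `R`-linear. -/
def commutator (hδ : IsLocalIdealDerivation I δ) {e : S} (he : IsSupportIdempotent I e) (a : R) :
    I →ₗ[R] S where
  toFun x := δ (a • x) - a • δ x
  map_add' x y := by
    rw [smul_add, map_add, map_add, smul_add, add_sub_add_comm]
  map_smul' b x := by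
    refine he.eq_of_forall_smul_eq ?_ ?_ fun y hy => ?_
    · rw [sub_mul, smul_mul_assoc, hδ.map_mul_eq_self he, hδ.map_mul_eq_self he]
    · rw [RingHom.id_apply, smul_mul_assoc, sub_mul, smul_mul_assoc, hδ.map_mul_eq_self he,
        hδ.map_mul_eq_self he]
    · have hx := hδ.smul_commutator a x ⟨y, hy⟩
      have hbx := hδ.smul_commutator a (b • x) ⟨y, hy⟩
      rw [← hbx, RingHom.id_apply, smul_comm y b, ← hx, Submodule.coe_smul, smul_assoc]

@[simp]
theorem commutator_apply (hδ : IsLocalIdealDerivation I δ) {e : S} (he : IsSupportIdempotent I e)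
    (a : R) (x : I) : hδ.commutator he a x = δ (a • x) - a • δ x :=
  rfl

theorem exists_derivation [IsScalarTower k R S] (hδ : IsLocalIdealDerivation I δ) {e : S}
    (he : IsSupportIdempotent I e) (hS : Module.Baer R S) :
    ∃ D : Derivation k R S, ∀ x : I, D x = δ x := by
  choose D hDe hD using fun a => he.exists_forall_smul_eq hS (hδ.commutator he a)
  simp only [commutator_apply] at hD
  have eq_D {a : R} {s : S} (hs : s * e = s) (h : ∀ x : I, x.1 • s = δ (a • x) - a • δ x) :
      D a = s :=
    he.eq_of_forall_smul_eq (hDe a) hs fun x hx => (hD a ⟨x, hx⟩).trans (h ⟨x, hx⟩).symm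
  have map_add (a b : R) : D (a + b) = D a + D b := eq_D (by rw [add_mul, hDe, hDe]) fun x => by
    rw [smul_add, hD, hD, add_smul, add_smul, _root_.map_add, sub_add_sub_comm]
  have map_smul (r : k) (a : R) : D (r • a) = r • D a :=
    eq_D (by rw [smul_mul_assoc, hDe]) fun x => by
      rw [smul_comm, hD, smul_assoc, smul_assoc, LinearMap.map_smul, smul_sub]
  have leibniz (a b : R) : D (a * b) = a • D b + b • D a :=
    eq_D (by rw [add_mul, smul_mul_assoc, smul_mul_assoc, hDe, hDe]) fun x => by
      have hb : (a • x).1 • D b = δ (b • a • x) - b • δ (a • x) := hD b (a • x)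
      rw [smul_add, smul_comm x.1 b, hD, ← mul_smul, mul_comm x.1 a, ← smul_eq_mul,
        ← Submodule.coe_smul, hb, smul_sub, smul_smul, smul_smul, mul_comm b a]
      abel
  refine ⟨Derivation.mk' ⟨⟨D, map_add⟩, map_smul⟩ leibniz, fun y => ?_⟩
  refine eq_D (hδ.map_mul_eq_self he y) fun x => ?_
  rw [hδ.leibniz, add_sub_cancel_left]

end IsLocalIdealDerivation

end Algebra

namespace StoneSpace

section Boolean

variable {B : Type*} [BooleanAlgebra B]

theorem mem_clopen {e : B} {t : StoneSpace B} : t ∈ clopen e ↔ t.val e = true :=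
  Iff.rfl

theorem clopen_inf (a b : B) : clopen (a ⊓ b) = clopen a ∩ clopen b := by
  ext t
  simp [mem_clopen]

theorem clopen_compl (a : B) : clopen aᶜ = (clopen a)ᶜ := by
  ext t
  simp [mem_clopen, val_compl]

theorem clopen_mono : Monotone (clopen (B := B)) := fun a b hab => by
  rw [← inf_eq_left.2 hab, clopen_inf]
  exact inter_subset_right

theorem clopen_eq_empty {e : B} : clopen e = ∅ ↔ e = ⊥ := by
  refine ⟨fun h => by_contra fun he => (nonempty_clopen he).ne_empty h, ?_⟩
  rintro rfl
  ext t
  simp [mem_clopen]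

theorem disjoint_clopen {a b : B} : Disjoint (clopen a) (clopen b) ↔ Disjoint a b := by
  rw [Set.disjoint_iff_inter_eq_empty, ← clopen_inf, clopen_eq_empty, disjoint_iff]

end Boolean

theorem clopen_sSup {B : Type*} [CompleteBooleanAlgebra B] (s : Set B) :
    clopen (sSup s) = closure (⋃ e ∈ s, clopen e) := by
  refine Subset.antisymm (fun t ht => by_contra fun hcl => ?_)
    (closure_minimal (iUnion₂_subset fun e he => clopen_mono (le_sSup he))
      (isClopen_clopen _).isClosed)
  obtain ⟨c, htc, hc⟩ := exists_clopen_subset isClosed_closure.isOpen_compl hcl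
  have hdisj : Disjoint c (sSup s) := disjoint_sSup_iff.2 fun e he =>
    disjoint_clopen.1 <| (disjoint_compl_left.mono_left hc).mono_right
      ((subset_biUnion_of_mem (u := clopen) he).trans subset_closure)
  exact Set.disjoint_left.1 (disjoint_clopen.2 hdisj) htc ht

end StoneSpace

namespace CInfty

section Germs

variable {Q : Type*} [TopologicalSpace Q]

theorem dense_union_compl_closure (V : Set Q) : Dense (V ∪ (closure V)ᶜ) := by
  simp only [dense_iff_closure_eq, closure_union, closure_compl, ← compl_subset_iff_union,
    compl_subset_compl]
  exact interior_subset

theorem forall_of_eventually_of_isClosed {P : Q → Prop} (hP : IsClosed {t | P t})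
    (h : ∀ᶠ t in denseOpen Q, P t) (t : Q) : P t := by
  obtain ⟨U, hU, -, hd⟩ := h
  exact closure_minimal hU hP (hd t)

theorem isClosed_setOf_eq_zero (x : CInfty Q) : IsClosed {t | x t = 0} :=
  isClosed_singleton.preimage x.toMap.continuous

theorem toReal_eq_zero_iff {x : CInfty Q} {t : Q} (ht : t ∈ x.finiteSet) :
    (x t).toReal = 0 ↔ x t = 0 := by
  rw [← EReal.coe_eq_zero, coe_toReal ht]

theorem mem_finiteSet_ofReal (a : C(Q, ℝ)) (t : Q) : t ∈ (ofReal a).finiteSet :=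
  ⟨EReal.coe_ne_top _, EReal.coe_ne_bot _⟩

theorem exists_mul_eq_zero_and_eventually_eq_one [ExtremallyDisconnected Q] (b : C(Q, ℝ)) :
    ∃ χ : C(Q, ℝ), χ * b = 0 ∧ ∀ᶠ t in denseOpen Q, b t ≠ 0 ∨ χ t = 1 := by
  set V : Set Q := {t | b t ≠ 0}
  have hV : IsOpen V := isOpen_ne.preimage b.continuous
  have hclopen : IsClopen (closure V)ᶜ :=
    ⟨(ExtremallyDisconnected.open_closure V hV).isClosed_compl, isClosed_closure.isOpen_compl⟩
  refine ⟨⟨(closure V)ᶜ.indicator 1, hclopen.continuous_indicator continuous_const⟩,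
    ContinuousMap.ext fun t => ?_, V ∪ (closure V)ᶜ, fun t ht => ?_,
    hV.union hclopen.isOpen, dense_union_compl_closure V⟩
  · by_cases ht : b t = 0
    · simp [ht]
    · have hχ : t ∉ (closure V)ᶜ := fun h => h (subset_closure ht)
      simp only [ContinuousMap.mul_apply, ContinuousMap.coe_mk, indicator_of_notMem hχ, zero_mul,
        ContinuousMap.zero_apply]
  · exact ht.imp id fun h => indicator_of_mem h 1

end Germs

variable {Q : Type*} [TopologicalSpace Q] [CompactSpace Q] [T2Space Q] [ExtremallyDisconnected Q]

theorem mul_eq_zero_iff {x y : CInfty Q} : x * y = 0 ↔ ∀ t, x t = 0 ∨ y t = 0 := by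
  constructor
  · refine fun h => forall_of_eventually_of_isClosed
      (x.isClosed_setOf_eq_zero.union y.isClosed_setOf_eq_zero) ?_
    filter_upwards [toReal_mul x y, x.eventually_finite, y.eventually_finite] with t hxy hx hy
    rw [h, toReal_zero, zero_eq_mul, toReal_eq_zero_iff hx, toReal_eq_zero_iff hy] at hxy
    exact hxy
  · refine fun h => eq_of_eventually ?_
    filter_upwards [toReal_mul x y] with t hxy
    rw [hxy, toReal_zero]
    rcases h t with h | h <;> simp [h]

theorem exists_eqOn_of_isOpen {V : Set Q} (hV : IsOpen V) {f : Q → ℝ} (hf : ContinuousOn f V) :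
    ∃ z : CInfty Q, ∀ t ∈ V, z t = f t := by
  set U : Set Q := V ∪ (closure V)ᶜ
  have hU : IsOpen U := hV.union isClosed_closure.isOpen_compl
  have hd : Dense U := dense_union_compl_closure V
  have hfV : ContinuousOn (V.indicator f) V := hf.congr fun t ht => indicator_of_mem ht f
  have hfc : ContinuousOn (V.indicator f) (closure V)ᶜ :=
    continuousOn_const.congr fun t ht => indicator_of_notMem (fun h => ht (subset_closure h)) f
  obtain ⟨z, hz⟩ := exists_continuous_extension hU hd
    (continuous_coe_real_ereal.comp_continuousOn
      (hfV.union_of_isOpen hfc hV isClosed_closure.isOpen_compl))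
  have hnd : IsNowhereDense {t | z t = ⊤ ∨ z t = ⊥} := by
    refine IsNowhereDense.mono (s := Uᶜ) (fun t ht hmem => ?_) ?_
    · rw [mem_ofPred_eq, hz t hmem] at ht
      exact ht.elim (EReal.coe_ne_top _) (EReal.coe_ne_bot _)
    · rw [hU.isClosed_compl.isNowhereDense_iff, interior_eq_empty_iff_dense_compl, compl_compl]
      exact hd
  refine ⟨⟨z, hnd⟩, fun t ht => (hz t (Or.inl ht)).trans ?_⟩
  rw [Function.comp_apply, indicator_of_mem ht]

theorem isUnit_of_eventually_ne_zero {x : CInfty Q}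
    (hx : ∀ᶠ t in denseOpen Q, (x t).toReal ≠ 0) : IsUnit x := by
  set V : Set Q := {t ∈ x.finiteSet | x t ≠ 0}
  have hV : IsOpen V := x.isOpen_finiteSet.inter x.isClosed_setOf_eq_zero.isOpen_compl
  have hinv : ContinuousOn (fun t => (x t).toReal⁻¹) V :=
    (x.continuousOn_toReal.mono fun t ht => ht.1).inv₀ fun t ht =>
      mt (toReal_eq_zero_iff ht.1).1 ht.2
  obtain ⟨y, hy⟩ := exists_eqOn_of_isOpen hV hinv
  refine IsUnit.of_mul_eq_one y (eq_of_eventually ?_)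
  filter_upwards [hx, x.eventually_finite, toReal_mul x y] with t hne ht hxy
  rw [hxy, hy t ⟨ht, mt (toReal_eq_zero_iff ht).2 hne⟩, EReal.toReal_coe, toReal_one,
    mul_inv_cancel₀ hne]

theorem exists_incl_eq_of_bounded {z : CInfty Q} {c : ℝ}
    (hz : ∀ᶠ t in denseOpen Q, |(z t).toReal| ≤ c) : ∃ a, incl a = z := by
  have hIcc : ∀ t, z t ∈ Icc ((-c : ℝ) : EReal) (c : EReal) := by
    refine forall_of_eventually_of_isClosed (isClosed_Icc.preimage z.toMap.continuous) ?_
    filter_upwards [hz, z.eventually_finite] with t htc ht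
    rw [← coe_toReal ht]
    exact ⟨EReal.coe_le_coe (abs_le.1 htc).1, EReal.coe_le_coe (abs_le.1 htc).2⟩
  have hfin (t : Q) : t ∈ z.finiteSet :=
    ⟨((hIcc t).2.trans_lt (EReal.coe_lt_top c)).ne, ((EReal.bot_lt_coe _).trans_le (hIcc t).1).ne'⟩
  have hcont : Continuous fun t => (z t).toReal := by
    rw [← continuousOn_univ]
    exact z.continuousOn_toReal.mono fun t _ => hfin t
  exact ⟨⟨_, hcont⟩, CInfty.ext (ContinuousMap.ext fun t => coe_toReal (hfin t))⟩

theorem incl_injective : Function.Injective (incl : C(Q, ℝ) →+* CInfty Q) := fun a b hab => by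
  ext t
  rw [← EReal.coe_eq_coe_iff, ← incl_apply, hab, incl_apply]

noncomputable instance : Algebra C(Q, ℝ) (CInfty Q) := incl.toAlgebra

instance : IsScalarTower ℝ C(Q, ℝ) (CInfty Q) := .of_algebraMap_eq fun _ => rfl

theorem smul_def (a : C(Q, ℝ)) (x : CInfty Q) : a • x = incl a * x := rfl

theorem smul_apply (a : C(Q, ℝ)) {x : CInfty Q} {t : Q} (ht : t ∈ x.finiteSet) :
    (a • x) t = (a t * (x t).toReal : ℝ) :=
  (mul_apply _ _ (mem_finiteSet_ofReal a t) ht).trans (by rw [toReal_ofReal])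

theorem isUnit_incl_of_mem_nonZeroDivisors {b : C(Q, ℝ)} (hb : b ∈ nonZeroDivisors C(Q, ℝ)) :
    IsUnit (incl b) := by
  obtain ⟨χ, hχb, hχ⟩ := exists_mul_eq_zero_and_eventually_eq_one b
  obtain rfl : χ = 0 := (mem_nonZeroDivisors_iff_right.1 hb) χ hχb
  refine isUnit_of_eventually_ne_zero (hχ.mono fun t ht => ?_)
  rw [incl_apply, EReal.toReal_coe]
  exact ht.resolve_right zero_ne_one

theorem exists_isUnit_incl_mul_eq_incl (z : CInfty Q) :
    ∃ a b : C(Q, ℝ), IsUnit (incl b) ∧ z * incl b = incl a := by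
  have hsq : ∀ᶠ t in denseOpen Q, ((1 + z * z) t).toReal = 1 + (z t).toReal ^ 2 := by
    filter_upwards [toReal_add 1 (z * z), toReal_mul z z] with t hadd hmul
    rw [hadd, hmul, toReal_one, sq]
  obtain ⟨u, hu⟩ := isUnit_of_eventually_ne_zero (hsq.mono fun t ht => by rw [ht]; positivity)
  set v : CInfty Q := ↑u⁻¹
  have hv : ∀ᶠ t in denseOpen Q, (v t).toReal = (1 + (z t).toReal ^ 2)⁻¹ := by
    filter_upwards [toReal_mul v u, hsq] with t hmul hsq
    rw [Units.inv_mul, hu, hsq, toReal_one] at hmul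
    exact eq_inv_of_mul_eq_one_left hmul.symm
  obtain ⟨b, hb⟩ := exists_incl_eq_of_bounded (z := v) (c := 1) <| hv.mono fun t ht => by
    rw [ht, abs_of_nonneg (by positivity)]
    exact inv_le_one_of_one_le₀ (by nlinarith)
  obtain ⟨a, ha⟩ := exists_incl_eq_of_bounded (z := z * v) (c := 1) <| by
    filter_upwards [hv, toReal_mul z v] with t hv hzv
    have hpos : 0 < 1 + (z t).toReal ^ 2 := by positivity
    rw [hzv, hv, ← div_eq_mul_inv, abs_div, abs_of_pos hpos]
    exact div_le_one_of_le₀ (by nlinarith [sq_abs (z t).toReal, sq_nonneg (|(z t).toReal| - 1)])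
      hpos.le
  exact ⟨a, b, hb ▸ u⁻¹.isUnit, by rw [hb, ha]⟩

instance : IsFractionRing C(Q, ℝ) (CInfty Q) where
  map_units b := isUnit_incl_of_mem_nonZeroDivisors b.2
  surj z := by
    obtain ⟨a, b, hb, hab⟩ := exists_isUnit_incl_mul_eq_incl z
    exact ⟨⟨a, b, mem_nonZeroDivisors_of_injective incl_injective hb.mem_nonZeroDivisors⟩, hab⟩
  exists_of_eq {a b} hab := ⟨1, by rw [incl_injective hab]⟩

theorem exists_forall_apply_eq_div {ι : Type*} {p : ι → C(Q, ℝ)} {q : ι → CInfty Q}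
    (h : ∀ i j, p i • q j = p j • q i) :
    ∃ w : CInfty Q, ∀ i, ∀ t ∈ (q i).finiteSet, p i t ≠ 0 →
      w t = ((q i t).toReal / p i t : ℝ) := by
  let V (i : ι) : Set Q := {t ∈ (q i).finiteSet | p i t ≠ 0}
  have hV (i : ι) : IsOpen (V i) :=
    (q i).isOpen_finiteSet.inter (isOpen_ne.preimage (p i).continuous)
  have hcompat (i j : ι) (t : Q) (hi : t ∈ V i) (hj : t ∈ V j) :
      (q i t).toReal / p i t = (q j t).toReal / p j t := by
    have hij : (p i • q j) t = (p j • q i) t := by rw [h i j]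
    rw [smul_apply _ hj.1, smul_apply _ hi.1, EReal.coe_eq_coe_iff] at hij
    rw [div_eq_div_iff hi.2 hj.2]
    linear_combination -hij
  have hglue (t : Q) (ht : t ∈ ⋃ i, V i) :
      ∃ r : ℝ, ∀ i, t ∈ V i → r = (q i t).toReal / p i t := by
    obtain ⟨i, hi⟩ := mem_iUnion.1 ht
    exact ⟨_, fun j hj => hcompat i j t hi hj⟩
  choose! f hf using hglue
  have hfV (i : ι) : EqOn f (fun t => (q i t).toReal / p i t) (V i) := fun t ht =>
    hf t (mem_iUnion_of_mem i ht) i ht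
  have hcont : ContinuousOn f (⋃ i, V i) := fun t ht => by
    obtain ⟨i, hi⟩ := mem_iUnion.1 ht
    have hquot : ContinuousOn (fun t => (q i t).toReal / p i t) (V i) :=
      ((q i).continuousOn_toReal.mono fun _ ht => ht.1).div (p i).continuous.continuousOn
        fun _ ht => ht.2
    exact ((hquot.congr (hfV i)).continuousAt ((hV i).mem_nhds hi)).continuousWithinAt
  obtain ⟨w, hw⟩ := exists_eqOn_of_isOpen (isOpen_iUnion hV) hcont
  exact ⟨w, fun i t ht hp => by rw [hw t (mem_iUnion_of_mem i ⟨ht, hp⟩), hfV i ⟨ht, hp⟩]⟩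

theorem eventually_ne_zero_or_map_eq_zero {I : Ideal C(Q, ℝ)} (g : I →ₗ[C(Q, ℝ)] CInfty Q)
    (x : I) : ∀ᶠ t in denseOpen Q, x.1 t ≠ 0 ∨ (g x t).toReal = 0 := by
  obtain ⟨χ, hχx, hχ⟩ := exists_mul_eq_zero_and_eventually_eq_one x.1
  have hχg : χ • g x = 0 := by
    rw [← map_smul, show χ • x = 0 from Subtype.ext hχx, map_zero]
  filter_upwards [hχ, (g x).eventually_finite] with t ht hfin
  refine ht.imp id fun h => ?_
  have h0 : ((χ • g x) t).toReal = 0 := by rw [hχg, toReal_zero]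
  rwa [smul_apply _ hfin, EReal.toReal_coe, h, one_mul] at h0

theorem baer : Module.Baer C(Q, ℝ) (CInfty Q) := fun I g => by
  have hsymm (x y : I) : x.1 • g y = y.1 • g x := by
    rw [← map_smul, ← map_smul]
    exact congrArg g (Subtype.ext (mul_comm x.1 y.1))
  obtain ⟨w, hw⟩ := exists_forall_apply_eq_div hsymm
  refine ⟨LinearMap.toSpanSingleton _ _ w, fun x hx => eq_of_eventually ?_⟩
  filter_upwards [eventually_ne_zero_or_map_eq_zero g ⟨x, hx⟩, (g ⟨x, hx⟩).eventually_finite,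
    w.eventually_finite] with t hxt hgt hwt
  rw [LinearMap.toSpanSingleton_apply, smul_apply _ hwt, EReal.toReal_coe]
  by_cases h0 : x t = 0
  · rw [h0, zero_mul, hxt.resolve_left (not_not.2 h0)]
  · rw [hw ⟨x, hx⟩ t hgt h0, EReal.toReal_coe, mul_div_cancel₀ _ h0]

end CInfty

section Support

open StoneSpace

variable {B : Type*} [CompleteBooleanAlgebra B]

theorem isIdempotentElem_idem (e : B) : IsIdempotentElem (idem e) := by
  rw [IsIdempotentElem, idem, ← map_mul]
  congr 1
  ext t
  by_cases ht : t ∈ clopen e <;> simp [idemFun, ht]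

theorem idem_top : idem (⊤ : B) = 1 := by
  rw [idem, ← map_one CInfty.incl]
  congr 1
  ext t
  simp [idemFun, mem_clopen]

theorem mul_idem_eq_zero_iff {v : LZero B} {e : B} :
    v * idem e = 0 ↔ clopen e ⊆ {t | v t = 0} := by
  simp only [CInfty.mul_eq_zero_iff, idem, CInfty.incl_apply, EReal.coe_eq_zero, idemFun,
    ContinuousMap.coe_mk, indicator_apply_eq_zero, Pi.one_apply, one_ne_zero, imp_false]
  exact forall_congr' fun t => or_comm.trans (or_iff_not_imp_left.trans (by rw [not_not]; rfl))

theorem clopen_supp (x : LZero B) : clopen (supp x) = closure {t | x t ≠ 0} := by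
  have idem_mul_eq_zero (e : B) : idem e * x = 0 ↔ clopen e ⊆ {t | x t = 0} := by
    rw [mul_comm, mul_idem_eq_zero_iff]
  rw [supp, clopen_compl]
  refine Subset.antisymm (compl_subset_comm.1 fun t ht => ?_)
    (closure_minimal (fun t hxt ht => hxt ?_) (isClopen_clopen _).compl.isClosed)
  · obtain ⟨e, hte, he⟩ := exists_clopen_subset isClosed_closure.isOpen_compl ht
    have hex : e ∈ {e | idem e * x = 0} := (idem_mul_eq_zero e).2 fun s hs =>
      by_contra fun hne => he hs (subset_closure hne)
    exact clopen_mono (le_sSup hex) hte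
  · have hzero : closure (⋃ e ∈ {e | idem e * x = 0}, clopen e) ⊆ {t | x t = 0} :=
      closure_minimal (iUnion₂_subset fun e he => (idem_mul_eq_zero e).1 he)
        x.isClosed_setOf_eq_zero
    rw [clopen_sSup] at ht
    exact hzero ht

theorem mul_idem_supp_eq_zero_iff {v x : LZero B} : v * idem (supp x) = 0 ↔ v * x = 0 := by
  rw [mul_idem_eq_zero_iff, clopen_supp, v.isClosed_setOf_eq_zero.closure_subset_iff,
    CInfty.mul_eq_zero_iff]
  exact forall_congr' fun t => or_iff_not_imp_right.symm

theorem mul_eq_zero_of_supp_le {v x y : LZero B} (hyx : supp y ≤ supp x) (hx : v * x = 0) :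
    v * y = 0 := by
  rw [← mul_idem_supp_eq_zero_iff, mul_idem_eq_zero_iff] at hx ⊢
  exact (clopen_mono hyx).trans hx

theorem mul_idem_iSup_eq_zero_iff {ι : Type*} {v : LZero B} {e : ι → B} :
    v * idem (⨆ i, e i) = 0 ↔ ∀ i, v * idem (e i) = 0 := by
  simp only [mul_idem_eq_zero_iff, iSup, clopen_sSup, v.isClosed_setOf_eq_zero.closure_subset_iff,
    biUnion_range, iUnion_subset_iff]

theorem isSupportIdempotent_idem_idealSupp (X : Ideal C(StoneSpace B, ℝ)) :
    IsSupportIdempotent X (idem (idealSupp X)) where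
  isIdempotentElem := isIdempotentElem_idem _
  mul_eq_zero_iff v := by
    rw [idealSupp, mul_idem_iSup_eq_zero_iff]
    simp only [mul_idem_supp_eq_zero_iff, Subtype.forall]
    rfl

theorem IsIdealDerivation.isLocalIdealDerivation {X : Ideal C(StoneSpace B, ℝ)}
    {δ : X →ₗ[ℝ] LZero B} (hder : IsIdealDerivation X δ) (hband : IsBandPreserving X δ) :
    IsLocalIdealDerivation X δ where
  leibniz x y := by
    rw [CInfty.smul_def, CInfty.smul_def, add_comm, mul_comm _ (δ x)]
    exact hder x y
  mul_eq_zero _ x := mul_eq_zero_of_supp_le (hband x)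

end Support

theorem mainTheorem5 {B : Type*} [CompleteBooleanAlgebra B]
    (X : Ideal C(StoneSpace B, ℝ)) (δ : X →ₗ[ℝ] LZero B)
    (hder : IsIdealDerivation X δ) (hband : IsBandPreserving X δ) :
    (∃ D : Derivation ℝ (LZero B) (LZero B), ∀ x : X, D (CInfty.incl x.1) = δ x) ∧
      (idealSupp X = ⊤ →
        ∃! D : Derivation ℝ (LZero B) (LZero B), ∀ x : X, D (CInfty.incl x.1) = δ x) := by
  have : Algebra.FormallyEtale C(StoneSpace B, ℝ) (LZero B) :=
    .of_isLocalization (nonZeroDivisors C(StoneSpace B, ℝ))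
  have hsupp := isSupportIdempotent_idem_idealSupp X
  obtain ⟨d, hd⟩ :=
    (hder.isLocalIdealDerivation hband).exists_derivation hsupp CInfty.baer
  obtain ⟨D, hD, hDunique⟩ := existsUnique_derivation_comp_algebraMap_eq ℝ
    C(StoneSpace B, ℝ) (LZero B) d
  have hDδ (x : X) : D (CInfty.incl x.1) = δ x := (hD x.1).trans (hd x)
  refine ⟨⟨D, hDδ⟩, fun htop => ⟨D, hDδ, fun D' hD' => hDunique D' fun a => ?_⟩⟩
  rw [htop, idem_top] at hsupp
  have hext : D'.compAlgebraMap C(StoneSpace B, ℝ) = d :=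
    derivation_eq_of_eqOn_ideal (fun _ => hsupp.eq_zero_of_forall_smul_eq_zero) fun x hx =>
      (hD' ⟨x, hx⟩).trans (hd ⟨x, hx⟩).symm
  exact congrFun (congrArg DFunLike.coe hext) a
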